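/- An \emph{expanded group} is a universal algebra $\mathbf A=\langle A;+,-,0,F\rangle$, where $\langle A;+,-,0\rangle$ is a (not necessarily commutative) group and $F$ is an arbitrary set of further finitary operations on $A$; it is finite if $A$ is finite. $\mathrm{Con}(\mathbf A)$ denotes its congruence lattice, with least element $0_A$ (equality) and greatest element $1_A$. For $\alpha,\beta\in\mathrm{Con}(\mathbf A)$, the (term condition) commutator $[\alpha,\beta]$ is the intersection of all congruences $\delta$ such that for all $n$, all $(n+1)$-ary term functions $t$ of $\mathbf A$, all $(a,b)\in\alpha$ and all $(c_1,d_1),\dots,(c_n,d_n)\in\beta$: if $(t(a,c_1,\dots,c_n),t(a,d_1,\dots,d_n))\in\delta$ then $(t(b,c_1,\dots,c_n),t(b,d_1,\dots,d_n))\in\delta$. $\mathbf A$ is \emph{nilpotent} if the series $\lambda_1=1_A$, $\lambda_{n+1}=[1_A,\lambda_n]$ satisfies $\lambda_k=0_A$ for some $k$. A lattice $L$ \emph{forces} a property $p$ in a class $K$ of algebras if every algebra $\mathbf A\in K$ with $\mathrm{Con}(\mathbf A)\cong L$ has the property $p$. Let $L$ be a complete lattice with greatest element $1$. An element $\eta\in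 L$ is called \emph{meet irreducible} if $\eta<\eta^+:=\bigwedge\{\beta\in L:\eta<\beta\}$; $M(L)$ is the set of these elements. An interval $[\alpha,\beta]$ is \emph{prime} if $\alpha<\beta$ and $[\alpha,\beta]=\{\alpha,\beta\}$. Write $[\alpha,\beta]\nearrow[\gamma,\delta]$ if $\delta=\beta\vee\gamma$ and $\alpha=\beta\wedge\gamma$; \emph{projectivity} is the smallest equivalence relation on intervals containing $\nearrow$. For a prime interval $[\alpha,\beta]$ put $$\Gamma(\alpha,\beta):=\bigvee\{\eta\in M(L): [\eta,\eta^+]\text{ is projective to }[\alpha,\beta]\}.$$ \textbf{Theorem.} Let $L$ be a lattice that is isomorphic to the congruence lattice of some finite expanded group. Then the following are equivalent: \begin{enumerate} \item $L$ forces nilpotency in the class of finite expanded groups. \item Every finite expanded group $\mathbf B$ with $\mathrm{Con}(\mathbf B)\cong L$ is nilpotent. \item For each prime interval $[\alpha,\beta]$ of $L$, we have $\Gamma(\alpha,\beta)=1$. \end{enumerate} -/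

import Mathlib

universe u v w

namespace CongruenceForcing

/-! ### Prime intervals, projectivity and the elements `Γ(α, β)` of a complete lattice

An interval `[α, β]` is represented by the pair `(α, β)` of its end points; a prime interval is
a pair with `α ⋖ β`. -/

section Lattice

variable {Λ : Type u} [CompleteLattice Λ]

/-- The element `η⁺`, the meet of all elements strictly above `η`. -/
def upperCover (η : Λ) : Λ := sInf {β | η < β}

/-- `η` is (completely) meet irreducible: `η` is strictly below the meet of all elements strictly
above it. In particular the top element is not meet irreducible. -/
def MeetIrreducible (η : Λ) : Prop := η < upperCover η

/-- `[α, β] ↗ [γ, δ]`, that is, `δ = β ⊔ γ` and `α = β ⊓ γ`. These equations force `α ≤ β` and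
`γ ≤ δ`, so that only (nonempty) intervals are related. -/
def TransposesUp (I J : Λ × Λ) : Prop := J.2 = I.2 ⊔ J.1 ∧ I.1 = I.2 ⊓ J.1

/-- Projectivity of intervals: the smallest equivalence relation containing `↗`. -/
def Projective : Λ × Λ → Λ × Λ → Prop := Relation.EqvGen TransposesUp

/-- `Γ(α, β)`, the join of all meet irreducible `η` such that `[η, η⁺]` is projective
to `[α, β]`. -/
def Gam (α β : Λ) : Λ := sSup {η | MeetIrreducible η ∧ Projective (η, upperCover η) (α, β)}

end Lattice

/-! ### Algebras, congruences, commutators -/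

/-- A universal algebra: a carrier with finitary operations indexed by an arbitrary signature
(a first-order language without relation symbols). -/
structure UAlgebra : Type (max (v + 1) (w + 1)) where
  lang : FirstOrder.Language.{w, 0}
  algebraic : lang.IsAlgebraic
  carrier : Type v
  str : lang.Structure carrier

namespace UAlgebra

instance (A : UAlgebra.{v, w}) : A.lang.Structure A.carrier := A.str

/-- An equivalence relation is a congruence if it is preserved by all fundamental operations. -/
def IsCongruence (A : UAlgebra.{v, w}) (r : Setoid A.carrier) : Prop :=
  ∀ (n : ℕ) (f : A.lang.Functions n) (x y : Fin n → A.carrier),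
    (∀ i, r (x i) (y i)) →
    r (FirstOrder.Language.Structure.funMap f x) (FirstOrder.Language.Structure.funMap f y)

/-- A congruence of `A`. -/
@[ext]
structure Congr (A : UAlgebra.{v, w}) : Type v where
  rel : Setoid A.carrier
  isCongruence : A.IsCongruence rel

variable {A : UAlgebra.{v, w}}

/-- Congruences are ordered by inclusion. -/
instance : PartialOrder A.Congr :=
  PartialOrder.lift Congr.rel fun _ _ h => Congr.ext h

/-- The infimum of a set of congruences is their intersection. -/
instance : InfSet A.Congr where
  sInf S := ⟨sInf (Congr.rel '' S), by
    rintro n f x y h _ ⟨r, hr, rfl⟩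
    exact r.isCongruence n f x y fun i => h i _ (Set.mem_image_of_mem _ hr)⟩

theorem isGLB_sInf_congr (S : Set A.Congr) : IsGLB S (sInf S) := by
  constructor
  · intro r hr
    exact (sInf_le (Set.mem_image_of_mem _ hr) : sInf (Congr.rel '' S) ≤ r.rel)
  · intro r hr
    refine (le_sInf ?_ : r.rel ≤ sInf (Congr.rel '' S))
    rintro _ ⟨s, hs, rfl⟩
    exact hr hs

/-- The complete lattice of congruences. The infimum is intersection, the top element is the
total relation and the bottom element is equality. -/
instance : CompleteLattice A.Congr where
  __ := completeLatticeOfInf A.Congr isGLB_sInf_congr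
  top := ⟨⊤, fun _ _ _ _ _ => trivial⟩
  le_top r := (le_top : r.rel ≤ ⊤)
  bot := ⟨⊥, fun _ _ _ _ h => congrArg _ (funext h)⟩
  bot_le r := (bot_le : ⊥ ≤ r.rel)

/-- The term condition: `α` centralizes `β` modulo `δ`. The `(n + 1)`-ary term functions of `A`
are the realizations of terms in the variables `0, …, n`. -/
def Centralizes (α β δ : A.Congr) : Prop :=
  ∀ (n : ℕ) (t : A.lang.Term (Fin (n + 1))) (a b : A.carrier) (c d : Fin n → A.carrier),
    α.rel a b → (∀ i, β.rel (c i) (d i)) →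
    δ.rel (t.realize (Fin.cons a c : Fin (n + 1) → A.carrier))
          (t.realize (Fin.cons a d : Fin (n + 1) → A.carrier)) →
    δ.rel (t.realize (Fin.cons b c : Fin (n + 1) → A.carrier))
          (t.realize (Fin.cons b d : Fin (n + 1) → A.carrier))

/-- The term condition commutator `[α, β]`: the intersection of all congruences `δ` such that
`α` centralizes `β` modulo `δ`. -/
def commutator (α β : A.Congr) : A.Congr := sInf {δ | Centralizes α β δ}

/-- The lower central series `1, [1, 1], [1, [1, 1]], …` (indexed from `0`). -/
def lowerCentral (A : UAlgebra.{v, w}) : ℕ → A.Congr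
  | 0 => ⊤
  | n + 1 => commutator ⊤ (lowerCentral A n)

/-- `A` is nilpotent if its lower central series reaches the equality relation. -/
def IsNilpotent (A : UAlgebra.{v, w}) : Prop := ∃ k : ℕ, A.lowerCentral k = ⊥

/-- `A` is an expanded group: among its fundamental operations there are a binary, a unary and a
nullary one that are the addition, the negation and the zero of a (not necessarily commutative)
group structure on the carrier. -/
def IsExpandedGroup (A : UAlgebra.{v, w}) : Prop :=
  ∃ _ : AddGroup A.carrier,
    (∃ f : A.lang.Functions 2, ∀ x y : A.carrier,
      FirstOrder.Language.Structure.funMap f ![x, y] = x + y) ∧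
    (∃ f : A.lang.Functions 1, ∀ x : A.carrier,
      FirstOrder.Language.Structure.funMap f ![x] = -x) ∧
    (∃ f : A.lang.Functions 0, FirstOrder.Language.Structure.funMap f ![] = (0 : A.carrier))

/-- The class of finite expanded groups (finite carrier, arbitrarily many operations). -/
def IsFiniteExpandedGroup (A : UAlgebra.{v, w}) : Prop :=
  Finite A.carrier ∧ A.IsExpandedGroup

end UAlgebra

/-- The lattice `Λ` forces the property `p` in the class `K` of algebras: every algebra in `K`
whose congruence lattice is isomorphic to `Λ` has the property `p`. -/
def Forces (Λ : Type u) [Lattice Λ] (K p : UAlgebra.{v, w} → Prop) : Prop :=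
  ∀ A : UAlgebra.{v, w}, K A → Nonempty (A.Congr ≃o Λ) → p A

end CongruenceForcing

namespace CongruenceForcing

/-! ### Transposed intervals in modular lattices, and invariance of `Gam` under isomorphism. -/

section Lattice

variable {Λ : Type u} [CompleteLattice Λ]

/-! Congruences of an expanded group permute. Hence their lattice is modular, centralizing is closed
under joins, and projective intervals have the same centralizers. Since η centralizes η⁺ modulo η,
Γ(α, β) centralizes β modulo α (`centralizes_gam`). If every Γ is 1, then [1, λ] lies below a lower
cover of λ for each nonzero λ, and in a finite algebra the lower central series reaches 0.

Conversely, let Γ(α, β) ≠ 1. `exists_localIdempotent_of_covBy` yields a nonzero idempotent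
congruence preserving map e with e(0) = 0 whose range lies in the 0-class of every congruence not
below Γ. Then f(a, b) = 0 for a in the 0-class of Γ, and f(a, b) = e(b) otherwise, preserves all
congruences. Adding f keeps the congruence lattice but destroys nilpotency.

The map e has minimal range among the idempotents that move some element of the 0-class of β out of
that of α. As in a local ring, each e ∘ r ∘ e is then a unit or nilpotent (`dichotomy`). So nonzero
fixed points of e generate join irreducible congruences. Incomparable ones give projective
intervals, and `cut` links comparable ones, so all these intervals are projective to [α, β]. -/

/-- `a` is the largest element strictly below `x`. -/
def IsLargestBelow (a x : Λ) : Prop := a < x ∧ ∀ w, w < x → w ≤ a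

theorem IsLargestBelow.transposesUp [IsModularLattice Λ] {a x z : Λ} (h : IsLargestBelow a x)
    (hz : ¬ x ≤ z) : TransposesUp (a, x) (a ⊔ z, x ⊔ z) := by
  have hxz : x ⊓ z ≤ a := h.2 _ (inf_le_left.lt_of_ne fun e => hz (inf_eq_left.1 e))
  refine ⟨?_, ?_⟩
  · change x ⊔ z = x ⊔ (a ⊔ z)
    rw [← sup_assoc, sup_eq_left.2 h.1.le]
  · change a = x ⊓ (a ⊔ z)
    rw [inf_comm, sup_inf_assoc_of_le z h.1.le, inf_comm z x, sup_eq_left.2 hxz]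

theorem IsLargestBelow.le_sup_of_lt [IsModularLattice Λ] {a x z w : Λ} (h : IsLargestBelow a x)
    (hzw : z ≤ w) (hw : w < x ⊔ z) : w ≤ a ⊔ z := by
  have hwx : w ⊓ x ≤ a := by
    refine h.2 _ (inf_le_right.lt_of_ne fun e => hw.not_ge (sup_le (inf_eq_right.1 e) hzw))
  calc w = w ⊓ (x ⊔ z) := (inf_eq_left.2 hw.le).symm
    _ = w ⊓ x ⊔ z := (inf_sup_assoc_of_le x hzw).symm
    _ ≤ a ⊔ z := sup_le_sup_right hwx z

theorem IsLargestBelow.sup_lt_sup [IsModularLattice Λ] {a x z : Λ} (h : IsLargestBelow a x)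
    (hz : ¬ x ≤ z) : a ⊔ z < x ⊔ z := by
  refine (sup_le_sup_right h.1.le z).lt_of_ne fun e => h.1.ne ?_
  have h2 : a = x ⊓ (a ⊔ z) := (h.transposesUp hz).2
  rw [e, inf_eq_left.2 le_sup_left] at h2
  exact h2

theorem IsLargestBelow.projective_of_sup_eq [IsModularLattice Λ] {a x b y z : Λ}
    (ha : IsLargestBelow a x) (hb : IsLargestBelow b y) (hx : ¬ x ≤ z) (hy : ¬ y ≤ z)
    (h : x ⊔ z = y ⊔ z) : Projective (a, x) (b, y) := by
  have e : a ⊔ z = b ⊔ z := le_antisymm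
    (hb.le_sup_of_lt le_sup_right (h ▸ ha.sup_lt_sup hx))
    (ha.le_sup_of_lt le_sup_right (h ▸ hb.sup_lt_sup hy))
  have h2 := hb.transposesUp hy
  rw [← e, ← h] at h2
  exact .trans _ _ _ (.rel _ _ (ha.transposesUp hx)) (.symm _ _ (.rel _ _ h2))

theorem IsLargestBelow.transposesUp_of_covBy [IsModularLattice Λ] {a x α β : Λ}
    (h : IsLargestBelow a x) (hαβ : α ⋖ β) (hxβ : x ≤ β) (hxα : ¬ x ≤ α) :
    TransposesUp (a, x) (α, β) := by
  have e : x ⊔ α = β := (hαβ.eq_or_eq le_sup_right (sup_le hxβ hαβ.le)).resolve_left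
    fun e => hxα (sup_eq_right.1 e)
  have h2 := h.transposesUp hxα
  rw [e] at h2
  have h3 := h.sup_lt_sup hxα
  rw [e] at h3
  rwa [(hαβ.eq_or_eq le_sup_right h3.le).resolve_right h3.ne] at h2

/-- Enlarge `δ` to an `η` maximal among the elements not above `x`. Maximality makes `η` meet
irreducible with cover `x ⊔ η`, and `[a, x]` transposes up to this prime interval. -/
theorem IsLargestBelow.le_gam [IsModularLattice Λ] [Finite Λ] {a x α β δ : Λ}
    (h : IsLargestBelow a x) (hp : Projective (a, x) (α, β)) (hδ : ¬ x ≤ δ) : δ ≤ Gam α β := by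
  obtain ⟨η, hδη, hη⟩ := (Set.toFinite {η : Λ | ¬ x ≤ η}).exists_le_maximal hδ
  have hmax : ∀ ζ, η < ζ → x ≤ ζ := fun ζ hζ => by
    by_contra hc
    exact hζ.not_ge (hη.2 hc hζ.le)
  have hlt : η < x ⊔ η := le_sup_right.lt_of_ne fun e => hη.1 (e ▸ le_sup_left)
  have hup : upperCover η = x ⊔ η := le_antisymm (sInf_le hlt)
    (le_sInf fun ζ hζ => sup_le (hmax ζ hζ) (le_of_lt hζ))
  have ha : a ⊔ η = η := by
    by_contra hc
    have h3 := hmax _ (le_sup_right.lt_of_ne (Ne.symm hc))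
    exact (h.sup_lt_sup hη.1).not_ge (sup_le h3 le_sup_right)
  have h2 := h.transposesUp hη.1
  rw [ha, ← hup] at h2
  refine hδη.trans (le_sSup ⟨?_, .trans _ _ _ (.symm _ _ (.rel _ _ h2)) hp⟩)
  change η < upperCover η
  rwa [hup]

theorem upperCover_map {Λ' : Type v} [CompleteLattice Λ'] (e : Λ ≃o Λ') (η : Λ) :
    upperCover (e η) = e (upperCover η) := by
  refine le_antisymm ?_ (le_sInf fun β hβ => ?_)
  · rw [← e.symm_apply_le]
    refine le_sInf fun β hβ => ?_
    rw [e.symm_apply_le]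
    exact sInf_le (e.lt_iff_lt.2 hβ)
  · rw [← e.le_symm_apply]
    exact sInf_le (e.lt_symm_apply.2 hβ)

theorem Projective.map {Λ' : Type v} [CompleteLattice Λ'] (e : Λ ≃o Λ') {I J : Λ × Λ}
    (h : Projective I J) : Projective (e I.1, e I.2) (e J.1, e J.2) := by
  induction h with
  | rel I J h =>
    refine .rel _ _ ⟨?_, ?_⟩
    · change e J.2 = e I.2 ⊔ e J.1
      rw [h.1, map_sup]
    · change e I.1 = e I.2 ⊓ e J.1
      rw [h.2, map_inf]
  | refl => exact .refl _
  | symm _ _ _ ih => exact .symm _ _ ih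
  | trans _ _ _ _ _ ih₁ ih₂ => exact .trans _ _ _ ih₁ ih₂

theorem map_gam_le {Λ' : Type v} [CompleteLattice Λ'] (e : Λ ≃o Λ') (α β : Λ) :
    e (Gam α β) ≤ Gam (e α) (e β) := by
  rw [Gam, e.map_sSup_eq_sSup_symm_preimage]
  refine sSup_le fun η hη => le_sSup ?_
  obtain ⟨h₁, h₂⟩ : MeetIrreducible (e.symm η) ∧
    Projective (e.symm η, upperCover (e.symm η)) (α, β) := hη
  have h₃ := h₂.map e
  rw [upperCover_map, e.apply_symm_apply] at h₃
  simp only [e.apply_symm_apply] at h₃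
  rw [MeetIrreducible, upperCover_map, e.symm.lt_iff_lt] at h₁
  exact ⟨h₁, h₃⟩

theorem gam_eq_top_of_orderIso {Λ' : Type v} [CompleteLattice Λ'] (e : Λ ≃o Λ')
    (h : ∀ α β : Λ, α ⋖ β → Gam α β = ⊤) (α β : Λ') (hαβ : α ⋖ β) : Gam α β = ⊤ := by
  have h₁ : e.symm α ⋖ e.symm β := (apply_covBy_apply_iff e.symm).2 hαβ
  have h₂ := map_gam_le e (e.symm α) (e.symm β)
  rw [h _ _ h₁, map_top] at h₂
  simpa using h₂

end Lattice

theorem exists_iterate_idempotent {X : Type v} [Finite X] (f : X → X) :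
    ∃ k, 0 < k ∧ ∀ x, f^[k] (f^[k] x) = f^[k] x := by
  obtain ⟨i, j, hij, h⟩ := Finite.exists_ne_map_eq_of_infinite fun n : ℕ => f^[n]
  wlog hlt : i < j generalizing i j
  · exact this j i hij.symm h.symm (by omega)
  obtain ⟨p, rfl⟩ := Nat.exists_eq_add_of_lt hlt
  have h₁ : ∀ n m, i ≤ m → f^[m + n * (p + 1)] = f^[m] := by
    intro n
    induction n with
    | zero => simp
    | succ n ih =>
      intro m hm
      obtain ⟨l, rfl⟩ := Nat.exists_eq_add_of_le hm
      rw [← ih _ hm, show i + l + (n + 1) * (p + 1) = (l + n * (p + 1)) + (i + p + 1) by ring,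
        Function.iterate_add, ← h, ← Function.iterate_add]
      congr 1
      ring
  -- A positive multiple of the period `p + 1` that is at least the preperiod `i`.
  refine ⟨(i + 1) * (p + 1), by positivity, fun x => ?_⟩
  rw [← Function.iterate_add_apply, h₁ _ _ (by nlinarith)]

/-! ### Permuting congruences and modularity. -/

namespace UAlgebra

variable {A : UAlgebra.{v, w}}

/-- All congruences of `A` are compatible with a group structure on the carrier. -/
structure GroupCompatible (A : UAlgebra.{v, w}) [AddGroup A.carrier] : Prop where
  add : ∀ (δ : A.Congr) {a a' b b' : A.carrier}, δ.rel a a' → δ.rel b b' → δ.rel (a + b) (a' + b')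
  neg : ∀ (δ : A.Congr) {a a' : A.carrier}, δ.rel a a' → δ.rel (-a) (-a')

theorem IsExpandedGroup.exists_groupCompatible (h : A.IsExpandedGroup) :
    ∃ _ : AddGroup A.carrier, A.GroupCompatible := by
  obtain ⟨G, ⟨f, hf⟩, ⟨g, hg⟩, -⟩ := h
  refine ⟨G, ⟨fun δ a a' b b' h₁ h₂ => ?_, fun δ a a' h₁ => ?_⟩⟩
  · rw [← hf, ← hf]
    refine δ.isCongruence _ _ _ _ fun i => ?_
    fin_cases i
    exacts [h₁, h₂]
  · rw [← hg, ← hg]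
    refine δ.isCongruence _ _ _ _ fun i => ?_
    fin_cases i
    exact h₁

instance [Finite A.carrier] : Finite A.Congr :=
  Finite.of_injective (fun δ : A.Congr => fun a b => δ.rel a b) fun _ _ h =>
    Congr.ext (Setoid.ext fun a b => iff_of_eq (congrFun (congrFun h a) b))

theorem Congr.realize (δ : A.Congr) {n : ℕ} (t : A.lang.Term (Fin n)) {x y : Fin n → A.carrier}
    (h : ∀ i, δ.rel (x i) (y i)) : δ.rel (t.realize x) (t.realize y) := by
  induction t with
  | var i => exact h i
  | func f ts ih => exact δ.isCongruence _ f _ _ ih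

theorem Congr.realize_cons (δ : A.Congr) {n : ℕ} (t : A.lang.Term (Fin (n + 1)))
    {a b : A.carrier} {c d : Fin n → A.carrier} (hab : δ.rel a b) (h : ∀ i, δ.rel (c i) (d i)) :
    δ.rel (t.realize (Fin.cons a c : Fin (n + 1) → A.carrier))
      (t.realize (Fin.cons b d : Fin (n + 1) → A.carrier)) :=
  δ.realize t (Fin.cases hab h)

theorem Congr.rel_inf {δ ε : A.Congr} {a b : A.carrier} :
    (δ ⊓ ε).rel a b ↔ δ.rel a b ∧ ε.rel a b := by
  refine ⟨fun h => ⟨(inf_le_left : δ ⊓ ε ≤ δ) h, (inf_le_right : δ ⊓ ε ≤ ε) h⟩, fun h => ?_⟩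
  rintro _ ⟨ζ, hζ, rfl⟩
  rcases hζ with rfl | rfl
  exacts [h.1, h.2]

theorem centralizes_self (η β : A.Congr) : Centralizes η β η := by
  intro n t a b c d hab _ H
  have h : ∀ e : Fin n → A.carrier,
      η.rel (t.realize (Fin.cons a e : Fin (n + 1) → A.carrier))
        (t.realize (Fin.cons b e : Fin (n + 1) → A.carrier)) :=
    fun e => η.realize_cons t hab fun i => η.rel.refl _
  exact η.rel.trans (η.rel.symm (h c)) (η.rel.trans H (h d))

theorem centralizes_bot (β α : A.Congr) : Centralizes ⊥ β α := by
  intro n t a b c d hab _ H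
  obtain rfl : a = b := hab
  exact H

section Group

variable [AddGroup A.carrier]

theorem GroupCompatible.rel_iff (hA : A.GroupCompatible) (δ : A.Congr) {a b : A.carrier} :
    δ.rel a b ↔ δ.rel 0 (-a + b) := by
  refine ⟨fun h => ?_, fun h => ?_⟩
  · simpa using hA.add δ (δ.rel.refl (-a)) h
  · simpa using hA.add δ (δ.rel.refl a) h

theorem GroupCompatible.rel_comp_comm (hA : A.GroupCompatible) {δ ε : A.Congr} {a b c : A.carrier}
    (h₁ : δ.rel a b) (h₂ : ε.rel b c) : ∃ d, ε.rel a d ∧ δ.rel d c := by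
  -- The Mal'cev term `x - y + z` makes congruences permute.
  refine ⟨a + -b + c, ?_, ?_⟩
  · simpa using hA.add ε (ε.rel.refl (a + -b)) h₂
  · simpa using hA.add δ (hA.add δ h₁ (δ.rel.refl (-b))) (δ.rel.refl c)

theorem GroupCompatible.rel_sup (hA : A.GroupCompatible) {δ ε : A.Congr} {a c : A.carrier} :
    (δ ⊔ ε).rel a c ↔ ∃ b, δ.rel a b ∧ ε.rel b c := by
  constructor
  · let ζ : A.Congr :=
      { rel :=
          { r := fun a c => ∃ b, δ.rel a b ∧ ε.rel b c
            iseqv :=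
              { refl := fun a => ⟨a, δ.rel.refl a, ε.rel.refl a⟩
                symm := fun ⟨b, h₁, h₂⟩ =>
                  hA.rel_comp_comm (ε.rel.symm h₂) (δ.rel.symm h₁)
                trans := fun ⟨b, h₁, h₂⟩ ⟨b', h₃, h₄⟩ => by
                  obtain ⟨m, h₅, h₆⟩ := hA.rel_comp_comm h₂ h₃
                  exact ⟨m, δ.rel.trans h₁ h₅, ε.rel.trans h₆ h₄⟩ } }
        isCongruence := fun n f x y h => by
          choose z hz using h
          exact ⟨_, δ.isCongruence n f x z fun i => (hz i).1,
            ε.isCongruence n f z y fun i => (hz i).2⟩ }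
    have h₁ : δ ≤ ζ := fun a b h => ⟨b, h, ε.rel.refl b⟩
    have h₂ : ε ≤ ζ := fun a b h => ⟨a, δ.rel.refl a, h⟩
    exact fun h => (sup_le h₁ h₂ : δ ⊔ ε ≤ ζ) h
  · rintro ⟨b, h₁, h₂⟩
    exact (δ ⊔ ε).rel.trans ((le_sup_left : δ ≤ δ ⊔ ε) h₁) ((le_sup_right : ε ≤ δ ⊔ ε) h₂)

theorem GroupCompatible.isModularLattice (hA : A.GroupCompatible) : IsModularLattice A.Congr := by
  refine ⟨fun {a} b {c} hac => ?_⟩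
  intro x y h
  obtain ⟨h₁, h₂⟩ := Congr.rel_inf.1 h
  obtain ⟨m, h₃, h₄⟩ := hA.rel_sup.1 h₁
  exact hA.rel_sup.2 ⟨m, h₃, Congr.rel_inf.2 ⟨h₄, c.rel.trans (c.rel.symm (hac h₃)) h₂⟩⟩

/-! ### Centralizers and projectivity -/

theorem GroupCompatible.centralizes_sup (hA : A.GroupCompatible)
    {γ γ' β α : A.Congr} (h : Centralizes γ β α)
    (h' : Centralizes γ' β α) : Centralizes (γ ⊔ γ') β α := by
  intro n t a b c d hab hcd H
  obtain ⟨m, h₁, h₂⟩ := hA.rel_sup.1 hab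
  exact h' n t m b c d h₂ hcd (h n t a m c d h₁ hcd H)

theorem GroupCompatible.centralizes_iff_of_transposesUp (hA : A.GroupCompatible)
    {I J : A.Congr × A.Congr}
    (h : TransposesUp I J) (ζ : A.Congr) : Centralizes ζ I.2 I.1 ↔ Centralizes ζ J.2 J.1 := by
  obtain ⟨α, β⟩ := I
  obtain ⟨γ, δ⟩ := J
  obtain ⟨rfl, rfl⟩ : δ = β ⊔ γ ∧ α = β ⊓ γ := h
  dsimp only
  constructor
  · intro H n t a b c d hab hcd h₁
    -- Split each pair through a middle point: replacing `d` by `m` changes values only modulo `γ`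
    -- and keeps the pair `(c, m)` in `β`.
    choose m hm₁ hm₂ using fun i => hA.rel_sup.1 (hcd i)
    have h₂ := γ.realize_cons t (γ.rel.refl a) hm₂
    have h₃ := γ.realize_cons t (γ.rel.refl b) hm₂
    have h₄ := β.realize_cons t (β.rel.refl a) hm₁
    exact γ.rel.trans (Congr.rel_inf.1 (H n t a b c m hab hm₁
      (Congr.rel_inf.2 ⟨h₄, γ.rel.trans h₁ (γ.rel.symm h₂)⟩))).2 h₃
  · intro H n t a b c d hab hcd h₁
    exact Congr.rel_inf.2 ⟨β.realize_cons t (β.rel.refl b) hcd,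
      H n t a b c d hab (fun i => (le_sup_left : β ≤ β ⊔ γ) (hcd i)) (Congr.rel_inf.1 h₁).2⟩

theorem GroupCompatible.centralizes_iff_of_projective (hA : A.GroupCompatible)
    {I J : A.Congr × A.Congr}
    (h : Projective I J) (ζ : A.Congr) : Centralizes ζ I.2 I.1 ↔ Centralizes ζ J.2 J.1 := by
  induction h with
  | rel I J h => exact hA.centralizes_iff_of_transposesUp h ζ
  | refl => exact Iff.rfl
  | symm _ _ _ ih => exact ih.symm
  | trans _ _ _ _ _ ih₁ ih₂ => exact ih₁.trans ih₂

theorem GroupCompatible.centralizes_gam (hA : A.GroupCompatible)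
    [Finite A.carrier] (α β : A.Congr) :
    Centralizes (Gam α β) β α := by
  have h : ∀ S : Set A.Congr, (∀ γ ∈ S, Centralizes γ β α) → Centralizes (sSup S) β α := by
    intro S
    induction S, S.toFinite using Set.Finite.induction_on with
    | empty =>
      intro _
      rw [sSup_empty]
      exact centralizes_bot β α
    | insert _ _ ih =>
      intro h
      rw [sSup_insert]
      exact hA.centralizes_sup (h _ (Set.mem_insert _ _))
        (ih fun γ hγ => h γ (Set.mem_insert_of_mem _ hγ))
  exact h _ fun η hη => (hA.centralizes_iff_of_projective hη.2 η).1 (centralizes_self η _)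

theorem GroupCompatible.isNilpotent_of_gam_eq_top (hA : A.GroupCompatible) [Finite A.carrier]
    (h : ∀ α β : A.Congr, α ⋖ β → Gam α β = ⊤) : A.IsNilpotent := by
  have key : ∀ n, A.lowerCentral n ≠ ⊥ → A.lowerCentral (n + 1) < A.lowerCentral n := by
    intro n hn
    obtain ⟨α, -, hα⟩ := exists_le_covBy_of_lt (bot_lt_iff_ne_bot.2 hn)
    have h₁ := hA.centralizes_gam α (A.lowerCentral n)
    rw [h _ _ hα] at h₁
    exact lt_of_le_of_lt (sInf_le h₁ : commutator ⊤ (A.lowerCentral n) ≤ α) hα.lt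
  by_contra hc
  have hc' : ∀ n, A.lowerCentral n ≠ ⊥ := fun n hn => hc ⟨n, hn⟩
  exact not_injective_infinite_finite _ (strictAnti_nat_of_succ_lt fun n => key n (hc' n)).injective

/-! ### Congruence preserving functions fixing zero -/

/-- `r` is a congruence preserving function with `r 0 = 0`. -/
structure ZeroPreserving (r : A.carrier → A.carrier) : Prop where
  zero : r 0 = 0
  rel : ∀ (δ : A.Congr) {a b : A.carrier}, δ.rel a b → δ.rel (r a) (r b)

theorem ZeroPreserving.rel_zero {r : A.carrier → A.carrier} (hr : ZeroPreserving r) (δ : A.Congr)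
    {a : A.carrier} (h : δ.rel 0 a) : δ.rel 0 (r a) := by
  simpa only [hr.zero] using hr.rel δ h

theorem ZeroPreserving.id : ZeroPreserving (id : A.carrier → A.carrier) := ⟨rfl, fun _ _ _ h => h⟩

theorem ZeroPreserving.comp {r s : A.carrier → A.carrier} (hr : ZeroPreserving r)
    (hs : ZeroPreserving s) : ZeroPreserving (r ∘ s) :=
  ⟨by simp [hr.zero, hs.zero], fun δ _ _ h => hr.rel δ (hs.rel δ h)⟩

theorem ZeroPreserving.iterate {r : A.carrier → A.carrier} (hr : ZeroPreserving r) (n : ℕ) :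
    ZeroPreserving r^[n] := by
  induction n with
  | zero => exact ZeroPreserving.id
  | succ n ih => exact ih.comp hr

/-- The principal congruence generated by `(0, x)`. -/
def GroupCompatible.gen (hA : A.GroupCompatible) (x : A.carrier) : A.Congr where
  rel :=
    -- All congruence preserving maps fixing 0 are allowed, not only polynomials; every congruence
    -- containing `(0, x)` still contains `(0, r x)`.
    { r := fun a b => ∃ r : A.carrier → A.carrier, ZeroPreserving r ∧ r x = -a + b
      iseqv :=
        { refl := fun a => ⟨fun _ => 0, ⟨rfl, fun δ _ _ _ => δ.rel.refl 0⟩, by simp⟩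
          symm := fun ⟨r, hr, h⟩ =>
            ⟨fun u => -r u, ⟨by simp [hr.zero], fun δ _ _ h => hA.neg δ (hr.rel δ h)⟩, by simp [h]⟩
          trans := fun ⟨r, hr, h⟩ ⟨s, hs, h'⟩ =>
            ⟨fun u => r u + s u,
              ⟨by simp [hr.zero, hs.zero], fun δ _ _ h => hA.add δ (hr.rel δ h) (hs.rel δ h)⟩,
              by simp [h, h', add_assoc]⟩ } }
  isCongruence := fun n f y z h => by
    choose r hr h using h
    refine ⟨fun u => -FirstOrder.Language.Structure.funMap f y +
      FirstOrder.Language.Structure.funMap f fun i => y i + r i u, ⟨?_, fun δ a b hab => ?_⟩, ?_⟩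
    · simp [fun i => (hr i).zero]
    · exact hA.add δ (δ.rel.refl _) (δ.isCongruence n f _ _ fun i =>
        hA.add δ (δ.rel.refl _) ((hr i).rel δ hab))
    · simp [h]

variable {hA : A.GroupCompatible}

theorem rel_gen_zero {x y : A.carrier} :
    (hA.gen x).rel 0 y ↔ ∃ r : A.carrier → A.carrier, ZeroPreserving r ∧ r x = y := by
  change (∃ r : A.carrier → A.carrier, ZeroPreserving r ∧ r x = -0 + y) ↔ _
  simp

theorem rel_gen_self (x : A.carrier) : (hA.gen x).rel 0 x :=
  rel_gen_zero.2 ⟨_, ZeroPreserving.id, rfl⟩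

theorem gen_le_iff {x : A.carrier} {δ : A.Congr} : hA.gen x ≤ δ ↔ δ.rel 0 x := by
  refine ⟨fun h => h (rel_gen_self x), fun h a b => ?_⟩
  rintro ⟨r, hr, hab⟩
  rw [hA.rel_iff, ← hab]
  exact hr.rel_zero δ h

/-! ### Local idempotents -/

/-- An idempotent `e` such that every `e ∘ r ∘ e` has a power that is `e` or `0`. -/
structure LocalIdempotent (e : A.carrier → A.carrier) : Prop where
  zeroPreserving : ZeroPreserving e
  idem : ∀ x, e (e x) = e x
  exists_iterate : ∀ r : A.carrier → A.carrier, ZeroPreserving r →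
    ∃ k, 0 < k ∧ ((∀ x, (e ∘ r ∘ e)^[k] x = e x) ∨ ∀ x, (e ∘ r ∘ e)^[k] x = 0)

theorem exists_localIdempotent [Finite A.carrier] (hA : A.GroupCompatible) {α β : A.Congr}
    (h : ¬ β ≤ α) : ∃ e : A.carrier → A.carrier, LocalIdempotent e ∧
      ∃ x, e x = x ∧ β.rel 0 x ∧ ¬ α.rel 0 x := by
  let S : Set (A.carrier → A.carrier) := {g | ZeroPreserving g ∧ (∀ x, g (g x) = g x) ∧
    ∃ y, β.rel 0 y ∧ ¬ α.rel 0 (g y)}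
  have hS : S.Nonempty := by
    refine ⟨id, ZeroPreserving.id, fun _ => rfl, ?_⟩
    by_contra! hc
    refine h fun a b hab => ?_
    rw [hA.rel_iff] at hab ⊢
    exact hc _ hab
  obtain ⟨e, ⟨he, hidem, y, hβ, hα⟩, hmin⟩ :=
    Set.exists_min_image S (fun g => (Set.range g).ncard) S.toFinite hS
  -- Minimality: a competitor absorbed by `e` on both sides has the same range, hence equals `e`.
  have hfix : ∀ g ∈ S, (∀ x, e (g x) = g x) → (∀ x, g (e x) = g x) → ∀ x, g x = e x := by
    intro g hg h₁ h₂ x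
    have hsub : Set.range g ⊆ Set.range e := by
      rintro _ ⟨z, rfl⟩
      exact ⟨_, h₁ z⟩
    have heq := Set.eq_of_subset_of_ncard_le hsub (hmin g hg)
    obtain ⟨z, hz⟩ : e x ∈ Set.range g := heq ▸ Set.mem_range_self x
    rw [← h₂, ← hz, hg.2.1]
  have hpow : ∀ r : A.carrier → A.carrier, ZeroPreserving r →
      ∃ k, 0 < k ∧ ZeroPreserving (e ∘ r ∘ e)^[k] ∧
        (∀ x, (e ∘ r ∘ e)^[k] ((e ∘ r ∘ e)^[k] x) = (e ∘ r ∘ e)^[k] x) ∧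
        (∀ x, e ((e ∘ r ∘ e)^[k] x) = (e ∘ r ∘ e)^[k] x) ∧
        ∀ x, (e ∘ r ∘ e)^[k] (e x) = (e ∘ r ∘ e)^[k] x := by
    intro r hr
    obtain ⟨k, hk, hi⟩ := exists_iterate_idempotent (e ∘ r ∘ e)
    refine ⟨k, hk, (he.comp (hr.comp he)).iterate k, hi, fun x => ?_, fun x => ?_⟩
    · obtain ⟨k, rfl⟩ := Nat.exists_eq_succ_of_ne_zero hk.ne'
      simp only [Function.iterate_succ_apply', Function.comp_apply, hidem]
    · obtain ⟨k, rfl⟩ := Nat.exists_eq_succ_of_ne_zero hk.ne'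
      simp only [Function.iterate_succ_apply, Function.comp_apply, hidem]
  have hβ' := he.rel_zero β hβ
  refine ⟨e, ⟨he, hidem, fun r hr => ?_⟩, e y, hidem y, hβ', hα⟩
  obtain ⟨k, hk, hg, hgi, heg, hge⟩ := hpow r hr
  refine ⟨k, hk, ?_⟩
  set g := (e ∘ r ∘ e)^[k] 
  by_cases hc : ∃ y, β.rel 0 y ∧ ¬ α.rel 0 (g y)
  · exact .inl (hfix g ⟨hg, hgi, hc⟩ heg hge)
  right
  push Not at hc
  -- Here `g` sends the 0-class of `β` into that of `α`, so the complement `-g + id` is the identity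
  -- modulo `α` at `e y`. Its idempotent power is therefore `e`; it also kills the range of `g`,
  -- which forces `g = 0`.
  have hs : ZeroPreserving fun x => -g x + x :=
    ⟨by simp [hg.zero], fun δ _ _ h => hA.add δ (hA.neg δ (hg.rel δ h)) h⟩
  obtain ⟨l, hl, hG, hGi, heG, hGe⟩ := hpow _ hs
  set q := e ∘ (fun x => -g x + x) ∘ e with hq_def
  have hq : ZeroPreserving q := he.comp (hs.comp he)
  have h₁ : α.rel (q (e y)) (e y) := by
    have h₂ : α.rel (-g (e y) + e y) (e y) := by
      simpa using hA.add α (hA.neg α (α.rel.symm (hc _ hβ'))) (α.rel.refl (e y))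
    simpa [hq_def, hidem] using he.rel α h₂
  have h₂ : ∀ n, α.rel (q^[n] (e y)) (e y) := by
    intro n
    induction n with
    | zero => exact α.rel.refl _
    | succ n ih =>
      rw [Function.iterate_succ_apply']
      exact α.rel.trans (hq.rel α ih) h₁
  have h₃ := hfix _ ⟨hG, hGi, e y, hβ', fun h => hα (α.rel.trans h (h₂ l))⟩ heG hGe
  intro x
  have h₄ : q (g x) = 0 := by simp [hq_def, heg, hgi, he.zero]
  obtain ⟨l, rfl⟩ := Nat.exists_eq_succ_of_ne_zero hl.ne'
  rw [← heg, ← h₃, Function.iterate_succ_apply, h₄]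
  exact (hq.iterate l).zero

/-- Iterate `e ∘ r ∘ e` modulo `δ`: if nilpotent, it cannot fix `x` modulo `δ` unless `x` is 0
modulo `δ`; if a unit, the same holds for killing `x`. -/
theorem LocalIdempotent.dichotomy {e : A.carrier → A.carrier} (he : LocalIdempotent e)
    {r : A.carrier → A.carrier} (hr : ZeroPreserving r) :
    (∀ (δ : A.Congr) x, e x = x → δ.rel (e (r x)) x → δ.rel 0 x) ∨
      ∀ (δ : A.Congr) x, e x = x → δ.rel 0 (e (r x)) → δ.rel 0 x := by
  obtain ⟨k, hk, h⟩ := he.exists_iterate r hr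
  have hq : ZeroPreserving (e ∘ r ∘ e) := he.zeroPreserving.comp (hr.comp he.zeroPreserving)
  have hqx : ∀ x, e x = x → (e ∘ r ∘ e) x = e (r x) := fun x hx => by simp [hx]
  rcases h with h | h
  · right
    intro δ x hx h₁
    rw [← hqx x hx] at h₁
    obtain ⟨k, rfl⟩ := Nat.exists_eq_succ_of_ne_zero hk.ne'
    rw [← hx, ← h, Function.iterate_succ_apply]
    exact (hq.iterate k).rel_zero δ h₁
  · left
    intro δ x hx h₁
    rw [← hqx x hx] at h₁
    rw [← h x]
    clear h hk
    induction k with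
    | zero => exact δ.rel.refl _
    | succ n ih =>
      rw [Function.iterate_succ_apply']
      exact δ.rel.trans (hq.rel δ ih) h₁

theorem LocalIdempotent.rel_or_rel {e : A.carrier → A.carrier} (hA : A.GroupCompatible)
    (he : LocalIdempotent e) {x : A.carrier} (hx : e x = x) {δ ε : A.Congr} (hδ : δ ≤ hA.gen x)
    (h : (δ ⊔ ε).rel 0 x) : δ.rel 0 x ∨ ε.rel 0 x := by
  obtain ⟨n, h₁, h₂⟩ := hA.rel_sup.1 h
  obtain ⟨r, hr, rfl⟩ := rel_gen_zero.1 (hδ h₁)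
  have h₃ := he.zeroPreserving.rel ε h₂
  rw [hx] at h₃
  exact (he.dichotomy hr).elim (fun H => .inr (H ε x hx h₃))
    fun H => .inl (H δ x hx (he.zeroPreserving.rel_zero δ h₁))

theorem LocalIdempotent.exists_isLargestBelow [Finite A.carrier] {e : A.carrier → A.carrier}
    (he : LocalIdempotent e) {x : A.carrier} (hx : e x = x) (h0 : x ≠ 0) :
    ∃ a, IsLargestBelow a (hA.gen x) := by
  have hne : ({w | w < hA.gen x} : Set A.Congr).Nonempty := by
    refine ⟨⊥, (bot_lt_iff_ne_bot.2 fun h => h0 ?_ : ⊥ < hA.gen x)⟩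
    exact (gen_le_iff.1 h.le : (0 : A.carrier) = x).symm
  obtain ⟨a, ha, hmax⟩ := (Set.toFinite {w | w < hA.gen x}).exists_maximal hne
  refine ⟨a, ha, fun w hw => ?_⟩
  refine le_sup_right.trans (hmax (y := a ⊔ w) ?_ le_sup_left)
  refine (sup_le (le_of_lt ha) hw.le).lt_of_ne fun heq => ?_
  rcases he.rel_or_rel hA hx (le_of_lt ha) (gen_le_iff.1 heq.ge) with h | h
  · exact (lt_iff_le_not_ge.1 ha).2 (gen_le_iff.2 h)
  · exact hw.not_ge (gen_le_iff.2 h)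

/-- Both intervals transpose up to one interval after joining with the congruence generated by `x +
y`. If that congruence contained `x`, say `r (x + y) = x`, then `e ∘ r` would fix `x` modulo `hA.gen
y` and kill `y` modulo `hA.gen x`, against `dichotomy`; likewise for `y`. -/
theorem LocalIdempotent.projective_of_incomparable {e : A.carrier → A.carrier}
    (he : LocalIdempotent e) {x y : A.carrier} (hx : e x = x) (hy : e y = y)
    (hxy : ¬ (hA.gen y).rel 0 x) (hyx : ¬ (hA.gen x).rel 0 y) {a b : A.Congr}
    (ha : IsLargestBelow a (hA.gen x)) (hb : IsLargestBelow b (hA.gen y)) :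
    Projective (a, hA.gen x) (b, hA.gen y) := by
  have := hA.isModularLattice
  have h₁ : (hA.gen y).rel (x + y) x := by
    simpa using hA.add _ ((hA.gen y).rel.refl x) ((hA.gen y).rel.symm (rel_gen_self (hA := hA) y))
  have h₂ : (hA.gen x).rel (x + y) y := by
    simpa using hA.add _ ((hA.gen x).rel.symm (rel_gen_self (hA := hA) x)) ((hA.gen x).rel.refl y)
  have hez := he.zeroPreserving
  refine ha.projective_of_sup_eq (z := hA.gen (x + y)) hb ?_ ?_ ?_
  · intro h
    obtain ⟨r, hr, hrx⟩ := rel_gen_zero.1 (gen_le_iff.1 h)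
    have h₃ := hez.rel _ (hr.rel _ h₁)
    have h₄ := hez.rel _ (hr.rel _ h₂)
    rw [hrx, hx] at h₃ h₄
    rcases he.dichotomy hr with H | H
    · exact hxy (H _ x hx ((hA.gen y).rel.symm h₃))
    · exact hyx (H _ y hy ((hA.gen x).rel.trans (rel_gen_self x) h₄))
  · intro h
    obtain ⟨r, hr, hry⟩ := rel_gen_zero.1 (gen_le_iff.1 h)
    have h₃ := hez.rel _ (hr.rel _ h₁)
    have h₄ := hez.rel _ (hr.rel _ h₂)
    rw [hry, hy] at h₃ h₄
    rcases he.dichotomy hr with H | H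
    · exact hyx (H _ y hy ((hA.gen x).rel.symm h₄))
    · exact hxy (H _ x hx ((hA.gen y).rel.trans (rel_gen_self y) h₃))
  · refine le_antisymm (sup_le (gen_le_iff.2 ?_) le_sup_right)
      (sup_le (gen_le_iff.2 ?_) le_sup_right)
    · rw [sup_comm]
      exact hA.rel_sup.2 ⟨x + y, rel_gen_self _, h₁⟩
    · rw [sup_comm]
      exact hA.rel_sup.2 ⟨x + y, rel_gen_self _, h₂⟩

/-- Truncating `e` to 0 outside `I` preserves congruences because `I` lies strictly below its
complement. The truncation fixes the fixed points in `I` and kills the others, so `dichotomy` leaves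
only one kind of nonzero fixed point. -/
theorem LocalIdempotent.cut {e : A.carrier → A.carrier} (he : LocalIdempotent e)
    {I : Set A.carrier} (hI0 : 0 ∈ I)
    (hI : ∀ u v, e u = u → e v = v → u ∈ I → v ∉ I → hA.gen u < hA.gen v) :
    (∀ u, e u = u → u ∈ I) ∨ ∀ u ∈ I, e u = u → u = 0 := by
  classical
  have hez := he.zeroPreserving
  have key : ∀ (δ : A.Congr) p q, e p = p → e q = q → p ∈ I → q ∉ I → δ.rel p q → δ.rel 0 p := by
    intro δ p q hp hq hpI hqI hpq
    have hn : δ.rel 0 (e (-p + q)) := hez.rel_zero δ (hA.rel_iff δ |>.1 hpq)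
    have hqn : (hA.gen p).rel (e (-p + q)) q := by
      have h₁ := hA.add _ (hA.neg _ (rel_gen_self (hA := hA) p)) ((hA.gen p).rel.refl q)
      have h₂ := hez.rel _ h₁
      rw [neg_zero, zero_add, hq] at h₂
      exact (hA.gen p).rel.symm h₂
    have hlt := hI p q hp hq hpI hqI
    -- If this difference were in `I`, then `q` would lie in the join of two congruences strictly
    -- below its own, contradicting `rel_or_rel`.
    by_cases hnI : e (-p + q) ∈ I
    · have hlt' := hI _ q (he.idem _) hq hnI hqI
      rcases he.rel_or_rel hA hq hlt'.le
        (hA.rel_sup.2 ⟨e (-p + q), rel_gen_self _, hqn⟩) with h | h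
      · exact absurd (gen_le_iff.2 h) hlt'.not_ge
      · exact absurd (gen_le_iff.2 h) hlt.not_ge
    · exact gen_le_iff.1 ((hI p _ hp (he.idem _) hpI hnI).le.trans (gen_le_iff.2 hn))
  have hr : ZeroPreserving fun x => if e x ∈ I then e x else 0 := by
    refine ⟨by simp [hez.zero], fun δ a b hab => ?_⟩
    have hab' := hez.rel δ hab
    split_ifs with h₁ h₂ h₂
    · exact hab'
    · exact δ.rel.symm (key δ _ _ (he.idem _) (he.idem _) h₁ h₂ hab')
    · exact key δ _ _ (he.idem _) (he.idem _) h₂ h₁ (δ.rel.symm hab')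
    · exact δ.rel.refl _
  rcases he.dichotomy hr with H | H
  · right
    intro u hu hue
    have h : (0 : A.carrier) = u := H ⊥ u hue (by
      simp only [hue, hu, if_true]
      exact (⊥ : A.Congr).rel.refl u)
    exact h.symm
  · left
    intro u hue
    by_contra hu
    have h : (0 : A.carrier) = u := H ⊥ u hue (by
      simp only [hue, hu, if_false, hez.zero]
      exact (⊥ : A.Congr).rel.refl 0)
    exact hu (h ▸ hI0)

theorem LocalIdempotent.exists_gen_le {e : A.carrier → A.carrier} (he : LocalIdempotent e)
    {P : A.carrier → Prop}
    (hP : ∀ v w, e v = v → e w = w → v ≠ 0 → w ≠ 0 → P v → ¬ P w →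
      hA.gen v < hA.gen w ∨ hA.gen w < hA.gen v)
    {w : A.carrier} (hw : e w = w) (hw0 : w ≠ 0) (hPw : ¬ P w) (u : A.carrier) (hu : e u = u) :
    ∃ w', e w' = w' ∧ w' ≠ 0 ∧ ¬ P w' ∧ hA.gen u ≤ hA.gen w' := by
  let I : Set A.carrier := {u | ∃ w', e w' = w' ∧ w' ≠ 0 ∧ ¬ P w' ∧ hA.gen u ≤ hA.gen w'}
  have h0 : (0 : A.carrier) ∈ I := ⟨w, hw, hw0, hPw, gen_le_iff.2 ((hA.gen w).rel.refl 0)⟩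
  refine (he.cut (hA := hA) (I := I) h0 fun u v hu hv huI hvI => ?_).elim (fun H => H u hu)
    fun H => absurd (H w ⟨w, hw, hw0, hPw, le_rfl⟩ hw) hw0
  obtain ⟨w', hw', hw0', hPw', hle⟩ := huI
  have hv0 : v ≠ 0 := fun h => hvI (h ▸ h0)
  have hPv : P v := by
    by_contra hc
    exact hvI ⟨v, hv, hv0, hc, le_rfl⟩
  rcases hP v w' hv hw' hv0 hw0' hPv hPw' with h | h
  · exact absurd ⟨w', hw', hw0', hPw', h.le⟩ hvI
  · exact hle.trans_lt h

/-- If both kinds occurred, each fixed point would lie below one of either kind, so alternating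
chains would climb past a maximal element. -/
theorem LocalIdempotent.forall_of_exists [Finite A.carrier] {e : A.carrier → A.carrier}
    (he : LocalIdempotent e) {P : A.carrier → Prop}
    (hP : ∀ v w, e v = v → e w = w → v ≠ 0 → w ≠ 0 → P v → ¬ P w →
      hA.gen v < hA.gen w ∨ hA.gen w < hA.gen v)
    {v : A.carrier} (hv : e v = v) (hv0 : v ≠ 0) (hPv : P v) (w : A.carrier) (hw : e w = w)
    (hw0 : w ≠ 0) : P w := by
  by_contra hPw
  obtain ⟨x, ⟨hx, hx0, hPx⟩, hmax⟩ := Set.Finite.exists_maximalFor (fun x => hA.gen x)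
    {x | e x = x ∧ x ≠ 0 ∧ P x} (Set.toFinite _) ⟨v, hv, hv0, hPv⟩
  obtain ⟨y, hy, hy0, hPy, hxy⟩ := he.exists_gen_le hP hw hw0 hPw x hx
  obtain ⟨z, hz, hz0, hPz, hyz⟩ := he.exists_gen_le (hA := hA) (P := fun x => ¬ P x)
    (fun a b ha hb ha0 hb0 h₁ h₂ => (hP b a hb ha hb0 ha0 (not_not.1 h₂) h₁).symm)
    hv hv0 (not_not.2 hPv) y hy
  rcases hP x y hx hy hx0 hy0 hPx hPy with h | h
  · exact (h.trans_le hyz).not_ge (hmax ⟨hz, hz0, not_not.1 hPz⟩ (h.le.trans hyz))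
  · exact h.not_ge hxy

theorem exists_localIdempotent_of_covBy [Finite A.carrier] (hA : A.GroupCompatible)
    {α β : A.Congr} (hαβ : α ⋖ β) : ∃ e : A.carrier → A.carrier, LocalIdempotent e ∧
      (∃ x, e x = x ∧ x ≠ 0) ∧ ∀ δ : A.Congr, ¬ δ ≤ Gam α β → ∀ x, e x = x → δ.rel 0 x := by
  have := hA.isModularLattice
  obtain ⟨e, he, x, hx, hβ, hα⟩ := exists_localIdempotent hA hαβ.lt.not_ge
  have hx0 : x ≠ 0 := fun h => hα (h ▸ α.rel.refl 0)
  refine ⟨e, he, ⟨x, hx, hx0⟩, fun δ hδ y hy => ?_⟩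
  by_cases hy0 : y = 0
  · exact hy0 ▸ δ.rel.refl 0
  obtain ⟨a, ha⟩ := he.exists_isLargestBelow (hA := hA) hx hx0
  have hpx : Projective (a, hA.gen x) (α, β) := .rel _ _
    (ha.transposesUp_of_covBy hαβ (gen_le_iff.2 hβ) fun h => hα (gen_le_iff.1 h))
  obtain ⟨b, hb, hpy⟩ := he.forall_of_exists (hA := hA)
    (P := fun y => ∃ b, IsLargestBelow b (hA.gen y) ∧ Projective (b, hA.gen y) (α, β))
    (fun v w hv hw hv0 hw0 ⟨b, hb, hbv⟩ hPw => by
      obtain ⟨c, hc⟩ := he.exists_isLargestBelow (hA := hA) hw hw0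
      by_contra! hcomp
      have hne : hA.gen v ≠ hA.gen w := fun h => hPw ⟨b, h ▸ hb, h ▸ hbv⟩
      have hp := he.projective_of_incomparable hv hw
        (fun h => hcomp.1 ((gen_le_iff.2 h).lt_of_ne hne))
        (fun h => hcomp.2 ((gen_le_iff.2 h).lt_of_ne hne.symm)) hb hc
      exact hPw ⟨c, hc, .trans _ _ _ (.symm _ _ hp) hbv⟩)
    hx hx0 ⟨a, ha, hpx⟩ y hy hy0
  by_contra hc
  exact hδ (hb.le_gam hpy fun h => hc (gen_le_iff.1 h))

end Group

/-! ### Adding a congruence preserving binary operation -/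

/-- The algebra `A` with an additional binary operation `f`. -/
def expand (A : UAlgebra.{v, w}) (f : A.carrier → A.carrier → A.carrier) : UAlgebra.{v, w} where
  lang := ⟨fun n => A.lang.Functions n ⊕ ULift.{w} (PLift (n = 2)), A.lang.Relations⟩
  algebraic := A.algebraic
  carrier := A.carrier
  str :=
    { funMap := fun {n} g => match n, g with
        | _, .inl g => FirstOrder.Language.Structure.funMap g
        | _, .inr ⟨⟨h⟩⟩ => fun x => f (x (Fin.cast h.symm 0)) (x (Fin.cast h.symm 1))
      RelMap := fun R => ((A.algebraic _).false R).elim }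

/-- The additional operation of `A.expand f` as a symbol of its language. -/
def expandSymbol (A : UAlgebra.{v, w}) (f : A.carrier → A.carrier → A.carrier) :
    (A.expand f).lang.Functions 2 := Sum.inr ⟨⟨rfl⟩⟩

theorem isExpandedGroup_expand (h : A.IsExpandedGroup)
    (f : A.carrier → A.carrier → A.carrier) : (A.expand f).IsExpandedGroup := by
  obtain ⟨G, ⟨p, hp⟩, ⟨q, hq⟩, z, hz⟩ := h
  exact ⟨G, ⟨Sum.inl p, hp⟩, ⟨Sum.inl q, hq⟩, Sum.inl z, hz⟩

/-- If `f` preserves all congruences of `A`, then `A.expand f` has the same congruences. -/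
def expandCongr (f : A.carrier → A.carrier → A.carrier)
    (hf : ∀ (δ : A.Congr) a a' b b', δ.rel a a' → δ.rel b b' → δ.rel (f a b) (f a' b')) :
    (A.expand f).Congr ≃o A.Congr where
  toFun δ := ⟨δ.rel, fun n g x y h => δ.isCongruence n (Sum.inl g) x y h⟩
  invFun δ := ⟨δ.rel, by
    rintro n (g | ⟨⟨h⟩⟩) x y hxy
    · exact δ.isCongruence n g x y hxy
    · exact hf δ _ _ _ _ (hxy _) (hxy _)⟩
  left_inv _ := rfl
  right_inv _ := rfl
  map_rel_iff' := Iff.rfl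

theorem GroupCompatible.exists_not_isNilpotent [AddGroup A.carrier] (hA : A.GroupCompatible)
    [Finite A.carrier] {α β : A.Congr} (hαβ : α ⋖ β) (hG : Gam α β ≠ ⊤) :
    ∃ f : A.carrier → A.carrier → A.carrier,
      (∀ (δ : A.Congr) a a' b b', δ.rel a a' → δ.rel b b' → δ.rel (f a b) (f a' b')) ∧
      ¬ (A.expand f).IsNilpotent := by
  classical
  obtain ⟨e, he, ⟨u, hu, hu0⟩, hδ⟩ := exists_localIdempotent_of_covBy hA hαβ
  set G := Gam α β
  obtain ⟨g, hg⟩ : ∃ g, ¬ G.rel 0 g := by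
    by_contra! hc
    refine hG (top_le_iff.1 fun a b _ => ?_)
    rw [hA.rel_iff]
    exact hc _
  have he0 := he.zeroPreserving.zero
  let f : A.carrier → A.carrier → A.carrier := fun a b => if G.rel 0 a then 0 else e b
  refine ⟨f, fun δ a a' b b' ha hb => ?_, ?_⟩
  · by_cases h : δ ≤ G
    · have hiff : G.rel 0 a ↔ G.rel 0 a' :=
        ⟨fun h' => G.rel.trans h' (h ha), fun h' => G.rel.trans h' (G.rel.symm (h ha))⟩
      simp only [f, hiff]
      split_ifs
      · exact δ.rel.refl 0
      · exact he.zeroPreserving.rel δ hb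
    · have h0 : ∀ a b, δ.rel 0 (f a b) := fun a b => by
        simp only [f]
        split_ifs
        · exact δ.rel.refl 0
        · exact hδ δ h _ (he.idem b)
      exact δ.rel.trans (δ.rel.symm (h0 a b)) (h0 a' b')
  · have key : ∀ n, ((A.expand f).lowerCentral n).rel (0 : A.carrier) u := by
      intro n
      induction n with
      | zero => trivial
      | succ n ih =>
        rintro _ ⟨δ, hδ, rfl⟩
        let t : (A.expand f).lang.Term (Fin 2) :=
          .func (A.expandSymbol f) fun i => .var i
        have ht : ∀ a b : (A.expand f).carrier,
            t.realize (Fin.cons a (fun _ => b) : Fin 2 → (A.expand f).carrier) = f a b :=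
          fun a b => rfl
        -- From `f 0 0 = f 0 u = 0`, the term condition yields that `f g 0 = 0` and `f g u = u` are
        -- congruent.
        have h := hδ 1 t (0 : A.carrier) g (fun _ => (0 : A.carrier)) (fun _ => u) trivial
          (fun _ => ih) (by
            erw [ht, ht]
            simp only [f, G.rel.refl 0, if_true]
            exact δ.rel.refl _)
        erw [ht, ht] at h
        simpa only [f, hg, if_false, he0, hu] using h
    rintro ⟨k, hk⟩
    have h := key k
    rw [hk] at h
    exact hu0 (h : (0 : A.carrier) = u).symm

end UAlgebra

end CongruenceForcing

theorem mainTheorem2 {Λ : Type u} [CompleteLattice Λ]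
    (hΛ : ∃ A : CongruenceForcing.UAlgebra.{v, w},
      A.IsFiniteExpandedGroup ∧ Nonempty (A.Congr ≃o Λ)) :
    List.TFAE [
      CongruenceForcing.Forces Λ
        CongruenceForcing.UAlgebra.IsFiniteExpandedGroup.{v, w}
        CongruenceForcing.UAlgebra.IsNilpotent.{v, w},
      ∀ B : CongruenceForcing.UAlgebra.{v, w},
        B.IsFiniteExpandedGroup → Nonempty (B.Congr ≃o Λ) → B.IsNilpotent,
      ∀ α β : Λ, α ⋖ β → CongruenceForcing.Gam α β = ⊤] := by
  tfae_have 1 ↔ 2 := Iff.rfl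
  tfae_have 3 → 2 := by
    rintro h B ⟨hfin, hB⟩ ⟨e⟩
    obtain ⟨G, hG⟩ := hB.exists_groupCompatible
    exact hG.isNilpotent_of_gam_eq_top (CongruenceForcing.gam_eq_top_of_orderIso e.symm h)
  tfae_have 2 → 3 := by
    obtain ⟨A, ⟨hfin, hA⟩, ⟨e⟩⟩ := hΛ
    intro h
    refine CongruenceForcing.gam_eq_top_of_orderIso e fun α β hαβ => ?_
    by_contra hc
    obtain ⟨G, hG⟩ := hA.exists_groupCompatible
    obtain ⟨f, hf, hn⟩ := hG.exists_not_isNilpotent hαβ hc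
    exact hn (h (A.expand f) ⟨hfin, CongruenceForcing.UAlgebra.isExpandedGroup_expand hA f⟩
      ⟨(CongruenceForcing.UAlgebra.expandCongr f hf).trans e⟩)
  tfae_finish
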